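/- Let $\mathcal F_t$ denote the class of $t$-boundaried graphs, that is, finite simple graphs $G$ together with a set $S\subseteq V(G)$ of at most $t$ vertices (the boundary) and an injective labelling $S\to\{1,\dots,t\}$. For $G_1,G_2\in\mathcal F_t$ let $G_1\oplus G_2$ be the graph obtained from the disjoint union of $G_1$ and $G_2$ by identifying equally labelled boundary vertices (two vertices being adjacent if an edge of $G_1$ or of $G_2$ joins them). Let $(G,k)\in\mathrm{DS}$ mean that $G$ has a dominating set of size at most $k$. Call $c\in\mathbb Z$ a transposition constant from $G_1$ to $G_2$ if for all $F\in\mathcal F_t$ and $k\in\mathbb Z$, $(G_1\oplus F,k)\in\mathrm{DS}\iff(G_2\oplus F,k+c)\in\mathrm{DS}$, and write $G_1\equiv_{\mathrm{DS},t}G_2$ if such a $c$ exists. For every fixed $h'\in\mathbb N$ there are a constant $\delta$ (depending only on $h'$) and an algorithm with the following property. Let $t\in\mathbb N$ and let $G$ be a $t$-boundaried graph with boundary $S$ (for instance with $t=|S|$), such that $S$ is a dominating set of $G$ and $G$ has at most $h'$ vertices of degree at least $h'$. Given $G$, the algorithm computes, in time polynomial in $|V(G)|$ (on a random access machine whose arithmetic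 operations are addition and subtraction, at unit cost), a $t$-boundaried graph $G'$ with the same boundary $S$ (boundary vertices being identified by their labels) such that $$G'\equiv_{\mathrm{DS},t}G\quad\text{and}\quad |V(G')|\le\delta\,|S|,$$ together with a transposition constant $c$ from $G$ to $G'$. -/

import Mathlib

/-! ### Boundaried graphs, gluing and equivalence -/

/-- A `t`-boundaried graph: a finite graph in which some vertices (the boundary) carry pairwise
distinct labels from a set of `t` labels.  Not all labels need to be used. -/
structure BoundariedGraph (t : ℕ) where
  /-- number of vertices -/
  n : ℕ
  /-- the underlying graph -/
  graph : SimpleGraph (Fin n)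
  /-- the label of a boundary vertex, `none` for the other vertices -/
  label : Fin n → Option (Fin t)
  label_inj : ∀ u v i, label u = some i → label v = some i → u = v

namespace BoundariedGraph

variable {t : ℕ}

/-- The boundary: the set of labelled vertices. -/
def boundary (G : BoundariedGraph t) : Finset (Fin G.n) :=
  Finset.univ.filter fun v => (G.label v).isSome

/-- Label of a vertex of the disjoint union of `G₁` and `G₂`. -/
def sumLabel (G₁ G₂ : BoundariedGraph t) : Fin G₁.n ⊕ Fin G₂.n → Option (Fin t) :=
  Sum.elim G₁.label G₂.label

/-- Equally labelled vertices of the disjoint union are identified. -/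
def glueSetoid (G₁ G₂ : BoundariedGraph t) : Setoid (Fin G₁.n ⊕ Fin G₂.n) where
  r x y := x = y ∨ ∃ i, sumLabel G₁ G₂ x = some i ∧ sumLabel G₁ G₂ y = some i
  iseqv :=
    { refl := fun _ => Or.inl rfl
      symm := by
        rintro x y (rfl | ⟨i, hx, hy⟩)
        · exact Or.inl rfl
        · exact Or.inr ⟨i, hy, hx⟩
      trans := by
        rintro x y z (rfl | ⟨i, hx, hy⟩) (rfl | ⟨j, hy', hz⟩)
        · exact Or.inl rfl
        · exact Or.inr ⟨j, hy', hz⟩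
        · exact Or.inr ⟨i, hx, hy⟩
        · rw [hy] at hy'
          cases hy'
          exact Or.inr ⟨i, hx, hz⟩ }

/-- Vertices of `G₁ ⊕ G₂`. -/
abbrev GlueVertex (G₁ G₂ : BoundariedGraph t) : Type :=
  Quotient (glueSetoid G₁ G₂)

/-- The vertex of `G₁ ⊕ G₂` coming from a vertex of `G₁`. -/
def glueLeft (G₁ G₂ : BoundariedGraph t) (u : Fin G₁.n) : GlueVertex G₁ G₂ :=
  Quotient.mk (glueSetoid G₁ G₂) (Sum.inl u)

/-- The vertex of `G₁ ⊕ G₂` coming from a vertex of `G₂`. -/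
def glueRight (G₁ G₂ : BoundariedGraph t) (v : Fin G₂.n) : GlueVertex G₁ G₂ :=
  Quotient.mk (glueSetoid G₁ G₂) (Sum.inr v)

theorem glueLeft_injective (G₁ G₂ : BoundariedGraph t) :
    Function.Injective (glueLeft G₁ G₂) := by
  intro u v h
  rcases Quotient.exact h with h | ⟨i, hu, hv⟩
  · exact Sum.inl.inj h
  · exact G₁.label_inj u v i hu hv

theorem glueRight_injective (G₁ G₂ : BoundariedGraph t) :
    Function.Injective (glueRight G₁ G₂) := by
  intro u v h
  rcases Quotient.exact h with h | ⟨i, hu, hv⟩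
  · exact Sum.inr.inj h
  · exact G₂.label_inj u v i hu hv

/-- The gluing `G₁ ⊕ G₂`: take the disjoint union and identify equally labelled vertices; two
vertices are adjacent if they are joined by an edge of `G₁` or by an edge of `G₂`. -/
def glue (G₁ G₂ : BoundariedGraph t) : SimpleGraph (GlueVertex G₁ G₂) where
  Adj x y :=
    (∃ u v, G₁.graph.Adj u v ∧ glueLeft G₁ G₂ u = x ∧ glueLeft G₁ G₂ v = y) ∨
    (∃ u v, G₂.graph.Adj u v ∧ glueRight G₁ G₂ u = x ∧ glueRight G₁ G₂ v = y)
  symm := ⟨by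
    rintro x y (⟨u, v, h, hx, hy⟩ | ⟨u, v, h, hx, hy⟩)
    · exact Or.inl ⟨v, u, h.symm, hy, hx⟩
    · exact Or.inr ⟨v, u, h.symm, hy, hx⟩⟩
  loopless := ⟨by
    rintro x (⟨u, v, h, hx, hy⟩ | ⟨u, v, h, hx, hy⟩)
    · exact h.ne (glueLeft_injective G₁ G₂ (hx.trans hy.symm))
    · exact h.ne (glueRight_injective G₁ G₂ (hx.trans hy.symm))⟩

end BoundariedGraph

/-- `D` is a dominating set of `G`: every vertex is in `D` or has a neighbour in `D`. -/
def IsDominatingSet {V : Type} (G : SimpleGraph V) (D : Finset V) : Prop :=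
  ∀ v, v ∈ D ∨ ∃ u ∈ D, G.Adj u v

/-- A parameterized graph problem, as the property of being a yes-instance. -/
abbrev GraphProblem : Type 1 := ∀ V : Type, SimpleGraph V → ℤ → Prop

/-- Dominating Set: does `G` have a dominating set of size at most `k`? -/
def DS : GraphProblem := fun V G k => ∃ D : Finset V, IsDominatingSet G D ∧ (D.card : ℤ) ≤ k

namespace BoundariedGraph

variable {t : ℕ}

/-- `c` is a transposition (translation) constant from `G₁` to `G₂` with respect to `P`. -/
def IsTranspositionConstant (P : GraphProblem) (G₁ G₂ : BoundariedGraph t) (c : ℤ) : Prop :=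
  ∀ (F : BoundariedGraph t) (k : ℤ),
    P (GlueVertex G₁ F) (glue G₁ F) k ↔ P (GlueVertex G₂ F) (glue G₂ F) (k + c)

/-- The relation `G₁ ≡_{P,t} G₂`. -/
def Equivalent (P : GraphProblem) (G₁ G₂ : BoundariedGraph t) : Prop :=
  ∃ c : ℤ, IsTranspositionConstant P G₁ G₂ c

/-- `G` and `G'` have the same boundary, terminals being identified through their labels. -/
def SameBoundary (G G' : BoundariedGraph t) : Prop :=
  ∀ i : Fin t, (∃ v, G.label v = some i) ↔ (∃ v, G'.label v = some i)

end BoundariedGraph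

/-! ### A random access machine with unit-cost steps

The memory consists of two-dimensional arrays of natural numbers; the arrays are named by natural
numbers, and a program can mention only finitely many of them.  Arithmetic is restricted to
addition and truncated subtraction. -/

namespace RAM

/-- `σ a i j` is the content of cell `(i, j)` of array `a`. -/
abbrev Memory : Type := ℕ → ℕ → ℕ → ℕ

/-- Expressions. -/
inductive Expr where
  | const (m : ℕ)
  | cell (a : ℕ) (i j : Expr)
  | add (e₁ e₂ : Expr)
  | sub (e₁ e₂ : Expr)

/-- Value of an expression. -/
def Expr.val (σ : Memory) : Expr → ℕ
  | .const m => m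
  | .cell a i j => σ a (i.val σ) (j.val σ)
  | .add e₁ e₂ => e₁.val σ + e₂.val σ
  | .sub e₁ e₂ => e₁.val σ - e₂.val σ

/-- Overwrite cell `(i, j)` of array `a` by `m`. -/
def Memory.write (σ : Memory) (a i j m : ℕ) : Memory := fun a' i' j' =>
  if a' = a ∧ i' = i ∧ j' = j then m else σ a' i' j'

/-- Programs.  A test `e` succeeds if the value of `e` is not `0`. -/
inductive Program where
  | skip
  | assign (a : ℕ) (i j e : Expr)
  | seq (p q : Program)
  | cond (e : Expr) (p q : Program)
  | loop (e : Expr) (p : Program)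

/-- `Exec p σ T σ'`: started in memory `σ`, the program `p` halts after exactly `T` steps with
memory `σ'`.  Each assignment and each test is one step (the expressions in a program have fixed
size, so each of them stands for a bounded number of elementary operations). -/
inductive Exec : Program → Memory → ℕ → Memory → Prop where
  | skip (σ : Memory) : Exec .skip σ 1 σ
  | assign (σ : Memory) (a : ℕ) (i j e : Expr) :
      Exec (.assign a i j e) σ 1 (σ.write a (i.val σ) (j.val σ) (e.val σ))
  | seq {p q : Program} {σ σ' σ'' : Memory} {T T' : ℕ} :
      Exec p σ T σ' → Exec q σ' T' σ'' → Exec (.seq p q) σ (T + T') σ''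
  | cond_true {e : Expr} {p q : Program} {σ σ' : Memory} {T : ℕ} :
      e.val σ ≠ 0 → Exec p σ T σ' → Exec (.cond e p q) σ (1 + T) σ'
  | cond_false {e : Expr} {p q : Program} {σ σ' : Memory} {T : ℕ} :
      e.val σ = 0 → Exec q σ T σ' → Exec (.cond e p q) σ (1 + T) σ'
  | loop_true {e : Expr} {p : Program} {σ σ' σ'' : Memory} {T T' : ℕ} :
      e.val σ ≠ 0 → Exec p σ T σ' → Exec (.loop e p) σ' T' σ'' →
        Exec (.loop e p) σ (1 + T + T') σ''
  | loop_false {e : Expr} {p : Program} {σ : Memory} :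
      e.val σ = 0 → Exec (.loop e p) σ 1 σ

/-- `σ` stores `G`: the number of vertices in cell `(0, 0)` of array `0`, the adjacency matrix in
array `1`, and in cell `(v, 0)` of array `2` the number `0` if `v` is not a boundary vertex and
`i + 1` if `v` is the boundary vertex with label `i`. -/
def Stores {t : ℕ} (σ : Memory) (G : BoundariedGraph t) : Prop :=
  σ 0 0 0 = G.n ∧
  (∀ u v : Fin G.n,
    (G.graph.Adj u v → σ 1 u v = 1) ∧ (¬ G.graph.Adj u v → σ 1 u v = 0)) ∧
  (∀ v : Fin G.n, σ 2 v 0 = (G.label v).elim 0 fun i => (i : ℕ) + 1)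

open Classical in
/-- The initial memory for the input `G`: it stores `G`, and every other cell is `0`. -/
noncomputable def input {t : ℕ} (G : BoundariedGraph t) : Memory := fun a i j =>
  if a = 0 ∧ i = 0 ∧ j = 0 then G.n
  else if a = 1 then
    if ∃ u v : Fin G.n, (u : ℕ) = i ∧ (v : ℕ) = j ∧ G.graph.Adj u v then 1 else 0
  else if a = 2 ∧ j = 0 then
    if h : i < G.n then (G.label ⟨i, h⟩).elim 0 fun l => (l : ℕ) + 1 else 0
  else 0

/-- The integer output in array `3`, written as a difference of two natural numbers. -/
def outputInt (σ : Memory) : ℤ := (σ 3 0 0 : ℤ) - (σ 3 0 1 : ℤ)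

end RAM

/-! ### Gluing, and dominating sets that use few vertices of `G` -/

namespace BoundariedGraph

variable {t : ℕ}

/-! Call the vertices of degree at least `h'` hubs, and let `S` be the boundary. Since `S` dominates
`G`, any dominating set of `G ⊕ F` can be exchanged for one, no larger, that uses at most `|S|`
vertices of `G`: replace all of its `G`-vertices by `S` (`exists_isDominatingSet_card_leftPart_le`).
A non-hub dominates at most `h'` vertices, so these few vertices cannot dominate more than `M = h' *
|S|` interior non-hubs unless a hub helps. If the latter are twins, that is, have the same hub
neighbours, then one chosen hub dominates all of them (`exists_hub_of_card_lt`). Vertices with more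
than `M` twins are therefore dominated by hubs for free.

An interior non-hub `z` is deleted if more than `M` twins precede it and each of its neighbours is a
hub or is itself such a heavy vertex. This is safe with transposition constant `0`
(`isTranspositionConstant_pullback`). A chosen `z` is replaced by a surviving twin, which serves the
same hubs, while the other neighbours of `z` are dominated by hubs anyway. Conversely, the surviving
twins of `z` force a hub that also dominates `z`.

A survivor is a hub, a boundary vertex, one of the first `M + 1` in its twin class, or a neighbour
of a non-hub that is a boundary vertex or not heavy. There are at most `2 ^ h'` classes and non-hubs
have small degree, so the total is linear in `|S|` (`ncard_isKept_le`).

All this is computable from sums over one index of expressions in addition and truncated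
subtraction, so the program is a fixed list of array-filling instructions whose defining equations
all hold in the memory it leaves (`Fill.runs_run`, `kernelFills_spec`). -/

theorem mem_boundary {G : BoundariedGraph t} {u : Fin G.n} :
    u ∈ G.boundary ↔ ∃ i, G.label u = some i := by
  simp [boundary, Option.isSome_iff_exists]

theorem label_eq_none_iff {G : BoundariedGraph t} {u : Fin G.n} :
    G.label u = none ↔ u ∉ G.boundary := by
  rw [mem_boundary, Option.eq_none_iff_forall_ne_some]
  simp

/-- The boundaried graph induced on the range of an injection. -/
abbrev pullback (G : BoundariedGraph t) {m : ℕ} (f : Fin m ↪ Fin G.n) : BoundariedGraph t where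
  n := m
  graph := G.graph.comap f
  label u := G.label (f u)
  label_inj _ _ i hu hv := f.injective (G.label_inj _ _ i hu hv)

theorem glue_cases (G F : BoundariedGraph t) (x : GlueVertex G F) :
    (∃ u, x = glueLeft G F u) ∨ ∃ v, x = glueRight G F v := by
  induction x using Quotient.inductionOn with
  | _ x =>
    rcases x with u | v
    · exact Or.inl ⟨u, rfl⟩
    · exact Or.inr ⟨v, rfl⟩

theorem mem_boundary_of_glueLeft_eq_glueRight {G F : BoundariedGraph t} {u : Fin G.n}
    {v : Fin F.n} (h : glueLeft G F u = glueRight G F v) : u ∈ G.boundary := by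
  rcases Quotient.exact h with h | ⟨i, hu, -⟩
  · cases h
  · exact mem_boundary.2 ⟨i, hu⟩

theorem glue_adj_glueLeft {G F : BoundariedGraph t} {u v : Fin G.n} (h : G.graph.Adj u v) :
    (glue G F).Adj (glueLeft G F u) (glueLeft G F v) :=
  Or.inl ⟨u, v, h, rfl, rfl⟩

theorem glue_adj_glueRight {G F : BoundariedGraph t} {u v : Fin F.n} (h : F.graph.Adj u v) :
    (glue G F).Adj (glueRight G F u) (glueRight G F v) :=
  Or.inr ⟨u, v, h, rfl, rfl⟩

theorem exists_of_glue_adj_glueLeft {G F : BoundariedGraph t} {u : Fin G.n}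
    (hu : u ∉ G.boundary) {y : GlueVertex G F} (h : (glue G F).Adj (glueLeft G F u) y) :
    ∃ v, G.graph.Adj u v ∧ y = glueLeft G F v := by
  rcases h with ⟨a, b, hab, ha, hb⟩ | ⟨a, b, hab, ha, hb⟩
  · cases glueLeft_injective G F ha
    exact ⟨b, hab, hb.symm⟩
  · exact absurd (mem_boundary_of_glueLeft_eq_glueRight ha.symm) hu

open Classical in
/-- The vertices of `G` in a set of vertices of `G ⊕ F`. -/
noncomputable def leftPart (G F : BoundariedGraph t) (D : Finset (GlueVertex G F)) :
    Finset (Fin G.n) :=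
  Finset.univ.filter fun u => glueLeft G F u ∈ D

theorem mem_leftPart {G F : BoundariedGraph t} {D : Finset (GlueVertex G F)} {u : Fin G.n} :
    u ∈ leftPart G F D ↔ glueLeft G F u ∈ D := by
  simp [leftPart]

/-- If the boundary dominates `G`, then a dominating set of `G ⊕ F` need not use more vertices
of `G` than there are boundary vertices. -/
theorem exists_isDominatingSet_card_leftPart_le {G F : BoundariedGraph t}
    (hG : IsDominatingSet G.graph G.boundary) {D : Finset (GlueVertex G F)}
    (hD : IsDominatingSet (glue G F) D) :
    ∃ D' : Finset (GlueVertex G F), IsDominatingSet (glue G F) D' ∧ D'.card ≤ D.card ∧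
      (leftPart G F D').card ≤ G.boundary.card := by
  classical
  by_cases hle : (leftPart G F D).card ≤ G.boundary.card
  · exact ⟨D, hD, le_rfl, hle⟩
  set I : Finset (GlueVertex G F) := Finset.univ.image (glueLeft G F) with hI
  have memI : ∀ x, x ∈ I ↔ ∃ u, glueLeft G F u = x := by simp [hI]
  -- The exchange: discard every vertex of `G` from `D` and take the boundary instead.
  refine ⟨(D \ I) ∪ G.boundary.image (glueLeft G F), ?_, ?_, ?_⟩
  · intro x
    by_cases hx : x ∈ I
    · obtain ⟨u, rfl⟩ := (memI x).1 hx
      rcases hG u with hu | ⟨v, hv, huv⟩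
      · exact Or.inl (Finset.mem_union_right _ (Finset.mem_image_of_mem _ hu))
      · exact Or.inr ⟨_, Finset.mem_union_right _ (Finset.mem_image_of_mem _ hv),
          glue_adj_glueLeft huv⟩
    · rcases hD x with hxD | ⟨y, hy, hxy⟩
      · exact Or.inl (Finset.mem_union_left _ (Finset.mem_sdiff.2 ⟨hxD, hx⟩))
      · refine Or.inr ⟨y, ?_, hxy⟩
        by_cases hyI : y ∈ I
        · obtain ⟨u, rfl⟩ := (memI y).1 hyI
          refine Finset.mem_union_right _ (Finset.mem_image_of_mem _ ?_)
          -- As `x` lies outside `G`, the edge comes from `F`, so its end in `G` is a boundary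
          -- vertex and is in the new set.
          rcases hxy with ⟨a, b, -, -, hb⟩ | ⟨a, b, -, ha, -⟩
          · exact absurd ((memI x).2 ⟨b, hb⟩) hx
          · exact mem_boundary_of_glueLeft_eq_glueRight ha.symm
        · exact Finset.mem_union_left _ (Finset.mem_sdiff.2 ⟨hy, hyI⟩)
  · have h1 : (D ∩ I).card = (leftPart G F D).card := by
      rw [← Finset.card_image_of_injective _ (glueLeft_injective G F)]
      congr 1
      ext x
      simp only [Finset.mem_inter, memI, Finset.mem_image, mem_leftPart]
      constructor
      · rintro ⟨h, u, rfl⟩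
        exact ⟨u, h, rfl⟩
      · rintro ⟨u, h, rfl⟩
        exact ⟨h, u, rfl⟩
    have h2 := Finset.card_sdiff_add_card_inter D I
    have h3 := Finset.card_union_le (D \ I) (G.boundary.image (glueLeft G F))
    have h4 : (G.boundary.image (glueLeft G F)).card ≤ G.boundary.card := Finset.card_image_le
    omega
  · refine Finset.card_le_card fun u hu => ?_
    rw [mem_leftPart, Finset.mem_union] at hu
    rcases hu with hu | hu
    · exact absurd ((memI _).2 ⟨u, rfl⟩) (Finset.mem_sdiff.1 hu).2
    · obtain ⟨v, hv, hvu⟩ := Finset.mem_image.1 hu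
      exact glueLeft_injective G F hvu ▸ hv

/-- A large set `C` of interior vertices with a common neighbourhood in `H` cannot be dominated by
few vertices of small degree, so some vertex of `H` dominates it. -/
theorem exists_hub_of_card_lt {G F : BoundariedGraph t} {D : Finset (GlueVertex G F)}
    (hD : IsDominatingSet (glue G F) D) (H : Set (Fin G.n)) {d s : ℕ}
    (hdeg : ∀ v, v ∉ H → {u | u = v ∨ G.graph.Adj v u}.ncard ≤ d)
    (hs : (leftPart G F D).card ≤ s) (C : Finset (Fin G.n))
    (hCS : ∀ c ∈ C, c ∉ G.boundary) (hCH : ∀ c ∈ C, c ∉ H)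
    (hC : ∀ c ∈ C, ∀ c' ∈ C, ∀ w ∈ H, G.graph.Adj c w → G.graph.Adj c' w)
    (hcard : d * s < C.card) :
    ∃ w ∈ H, glueLeft G F w ∈ D ∧ ∀ c ∈ C, G.graph.Adj c w := by
  classical
  by_contra hcon
  push Not at hcon
  -- A hub adjacent to one vertex of `C` is adjacent to all. If no chosen hub dominates `C`, then
  -- the closed neighbourhoods of the chosen non-hubs cover `C`, and these are too small in total.
  have hsub : C ⊆ ((leftPart G F D).filter (· ∉ H)).biUnion
      fun v => Finset.univ.filter fun u => u = v ∨ G.graph.Adj v u := by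
    intro c hc
    simp only [Finset.mem_biUnion, Finset.mem_filter, mem_leftPart, Finset.mem_univ, true_and]
    rcases hD (glueLeft G F c) with h | ⟨y, hy, hcy⟩
    · exact ⟨c, ⟨h, hCH c hc⟩, Or.inl rfl⟩
    · obtain ⟨v, hcv, rfl⟩ := exists_of_glue_adj_glueLeft (hCS c hc) hcy.symm
      refine ⟨v, ⟨hy, fun hv => ?_⟩, Or.inr hcv.symm⟩
      obtain ⟨c', hc', hn⟩ := hcon v hv hy
      exact hn (hC c hc c' hc' v hv hcv)
  have h1 := (Finset.card_le_card hsub).trans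
    (Finset.card_biUnion_le_card_mul _ _ d fun v hv => by
      have := hdeg v (Finset.mem_filter.1 hv).2
      rwa [Set.ncard_eq_toFinset_card', Set.toFinset_ofPred] at this)
  have h2 : ((leftPart G F D).filter (· ∉ H)).card ≤ s :=
    (Finset.card_filter_le _ _).trans hs
  have := Nat.mul_le_mul_right d h2
  rw [mul_comm d s] at hcard
  omega

/-! ### Gluing onto an induced subgraph -/

section Pullback

variable (G : BoundariedGraph t) {m : ℕ} (f : Fin m ↪ Fin G.n) (F : BoundariedGraph t)

/-- The inclusion of the gluing of an induced subgraph. -/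
def glueMap : GlueVertex (G.pullback f) F → GlueVertex G F :=
  Quotient.map (Sum.map f id) (by
    rintro x y (rfl | ⟨i, hx, hy⟩)
    · exact Or.inl rfl
    · refine Or.inr ⟨i, ?_, ?_⟩
      · rcases x with x | x <;> exact hx
      · rcases y with y | y <;> exact hy)

@[simp] theorem glueMap_glueLeft (u : Fin m) :
    glueMap G f F (glueLeft (G.pullback f) F u) = glueLeft G F (f u) := rfl

@[simp] theorem glueMap_glueRight (v : Fin F.n) :
    glueMap G f F (glueRight (G.pullback f) F v) = glueRight G F v := rfl

theorem glueMap_injective : Function.Injective (glueMap G f F) := by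
  intro x y
  induction x using Quotient.inductionOn with | _ x => ?_
  induction y using Quotient.inductionOn with | _ y => ?_
  intro h
  rcases Quotient.exact h with h | ⟨i, hx, hy⟩
  · have : Function.Injective (Sum.map f (id : Fin F.n → Fin F.n)) :=
      Function.Injective.sumMap f.injective Function.injective_id
    exact congrArg _ (this h)
  · refine Quotient.sound (Or.inr ⟨i, ?_, ?_⟩)
    · rcases x with x | x <;> exact hx
    · rcases y with y | y <;> exact hy

variable {G f F}

theorem glueMap_adj {x y : GlueVertex (G.pullback f) F} (h : (glue (G.pullback f) F).Adj x y) :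
    (glue G F).Adj (glueMap G f F x) (glueMap G f F y) := by
  rcases h with ⟨a, b, hab, rfl, rfl⟩ | ⟨a, b, hab, rfl, rfl⟩
  · exact glue_adj_glueLeft (show G.graph.Adj (f a) (f b) from hab)
  · exact glue_adj_glueRight hab

theorem mem_range_of_glueMap_eq (hS : ∀ u ∈ G.boundary, u ∈ Set.range f)
    {x : GlueVertex (G.pullback f) F} {z : Fin G.n} (h : glueMap G f F x = glueLeft G F z) :
    z ∈ Set.range f := by
  rcases glue_cases _ _ x with ⟨u, rfl⟩ | ⟨v, rfl⟩
  · exact ⟨u, glueLeft_injective G F h⟩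
  · exact hS _ (mem_boundary_of_glueLeft_eq_glueRight h.symm)

/-- Keeping the whole boundary is essential: a deleted boundary vertex could reappear through `F`,
without the edges it had in `G`. -/
theorem adj_of_glueMap_adj (hS : ∀ u ∈ G.boundary, u ∈ Set.range f)
    {x y : GlueVertex (G.pullback f) F}
    (h : (glue G F).Adj (glueMap G f F x) (glueMap G f F y)) :
    (glue (G.pullback f) F).Adj x y := by
  rcases h with ⟨a, b, hab, ha, hb⟩ | ⟨a, b, hab, ha, hb⟩
  · obtain ⟨a, rfl⟩ := mem_range_of_glueMap_eq hS ha.symm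
    obtain ⟨b, rfl⟩ := mem_range_of_glueMap_eq hS hb.symm
    rw [← glueMap_glueLeft] at ha hb
    rw [← glueMap_injective G f F ha, ← glueMap_injective G f F hb]
    exact glue_adj_glueLeft (show G.graph.Adj (f a) (f b) from hab)
  · rw [← glueMap_glueRight G f] at ha hb
    rw [← glueMap_injective G f F ha, ← glueMap_injective G f F hb]
    exact glue_adj_glueRight hab

end Pullback

/-! ### Twins, and the safety of deleting vertices -/

/-- Vertices that are neither boundary vertices nor in `H`. -/
def IsLow (G : BoundariedGraph t) (H : Set (Fin G.n)) (v : Fin G.n) : Prop :=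
  v ∉ H ∧ v ∉ G.boundary

/-- `v` is a low vertex with the same neighbours in `H` as `u`. -/
def IsTwin (G : BoundariedGraph t) (H : Set (Fin G.n)) (u v : Fin G.n) : Prop :=
  G.IsLow H v ∧ ∀ w ∈ H, G.graph.Adj u w ↔ G.graph.Adj v w

section Reduction

variable {G : BoundariedGraph t} {m : ℕ} {f : Fin m ↪ Fin G.n} {H : Set (Fin G.n)} {d : ℕ}

/-- In a dominating set using few vertices of `G`, each vertex with many twins is dominated by a
vertex of `H`. -/
theorem exists_hub_adj {F : BoundariedGraph t} {D : Finset (GlueVertex G F)}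
    (hD : IsDominatingSet (glue G F) D)
    (hDle : (leftPart G F D).card ≤ G.boundary.card)
    (hdeg : ∀ v, v ∉ H → {u | u = v ∨ G.graph.Adj v u}.ncard ≤ d) {z : Fin G.n}
    (hz : d * G.boundary.card < {v | G.IsTwin H z v}.ncard) :
    ∃ w ∈ H, glueLeft G F w ∈ D ∧ G.graph.Adj z w := by
  classical
  rw [Set.ncard_eq_toFinset_card', Set.toFinset_ofPred] at hz
  obtain ⟨w, hw, hwD, hadj⟩ := exists_hub_of_card_lt hD H hdeg hDle
    (Finset.univ.filter fun v => G.IsTwin H z v)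
    (fun c hc => (Finset.mem_filter.1 hc).2.1.2) (fun c hc => (Finset.mem_filter.1 hc).2.1.1)
    (fun c hc c' hc' w hw h => ((Finset.mem_filter.1 hc').2.2 w hw).1
      (((Finset.mem_filter.1 hc).2.2 w hw).2 h)) hz
  -- `z` need not be low, hence need not belong to its own class; adjacency is carried back to it
  -- from some member `c`.
  obtain ⟨c, hc⟩ := Finset.card_pos.1 (lt_of_le_of_lt (Nat.zero_le _) hz)
  exact ⟨w, hw, hwD, ((Finset.mem_filter.1 hc).2.2 w hw).2 (hadj c hc)⟩

theorem mem_boundary_pullback {u : Fin m} :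
    u ∈ (G.pullback f).boundary ↔ f u ∈ G.boundary := by
  rw [mem_boundary, mem_boundary]

theorem card_boundary_pullback (hS : ∀ u ∈ G.boundary, u ∈ Set.range f) :
    (G.pullback f).boundary.card = G.boundary.card := by
  rw [← Finset.card_map f]
  congr 1
  ext u
  rw [Finset.mem_map]
  constructor
  · rintro ⟨v, h, rfl⟩
    exact mem_boundary_pullback.1 h
  · intro h
    obtain ⟨v, rfl⟩ := hS u h
    exact ⟨v, mem_boundary_pullback.2 h, rfl⟩

theorem isDominatingSet_boundary_pullback (hG : IsDominatingSet G.graph G.boundary)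
    (hS : ∀ u ∈ G.boundary, u ∈ Set.range f) :
    IsDominatingSet (G.pullback f).graph (G.pullback f).boundary := by
  intro (u : Fin m)
  rcases hG (f u) with h | ⟨v, hv, huv⟩
  · exact Or.inl (mem_boundary_pullback.2 h)
  · obtain ⟨v, rfl⟩ := hS v hv
    exact Or.inr ⟨v, mem_boundary_pullback.2 hv, huv⟩

/-- Deleting low vertices that keep many twins, and all of whose neighbours are in `H` or keep many
twins, does not change the size of a dominating set, whatever is glued to the graph. -/
theorem isTranspositionConstant_pullback (hG : IsDominatingSet G.graph G.boundary)
    (hdeg : ∀ v, v ∉ H → {u | u = v ∨ G.graph.Adj v u}.ncard ≤ d)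
    (hlow : ∀ z, z ∉ Set.range f → G.IsLow H z)
    (hmany : ∀ z, z ∉ Set.range f →
      d * G.boundary.card < {v | G.IsTwin H z (f v)}.ncard)
    (hnbr : ∀ z, z ∉ Set.range f → ∀ w, G.graph.Adj z w → w ∉ H →
      w ∉ G.boundary ∧ d * G.boundary.card < {v | G.IsTwin H w (f v)}.ncard) :
    IsTranspositionConstant DS G (G.pullback f) 0 := by
  classical
  have hS : ∀ u ∈ G.boundary, u ∈ Set.range f := fun u hu => by
    by_contra h
    exact (hlow u h).2 hu
  have hH : ∀ u ∈ H, u ∈ Set.range f := fun u hu => by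
    by_contra h
    exact (hlow u h).1 hu
  have htwin : ∀ z, {v | G.IsTwin H z (f v)}.ncard ≤ {v | G.IsTwin H z v}.ncard := fun z => by
    rw [← Set.ncard_image_of_injective _ f.injective]
    refine Set.ncard_le_ncard ?_ (Set.toFinite _)
    rintro _ ⟨v, hv, rfl⟩
    exact hv
  intro F k
  rw [add_zero]
  constructor
  · rintro ⟨D₀, hD₀, hk⟩
    obtain ⟨D, hD, hle, hDS⟩ := exists_isDominatingSet_card_leftPart_le hG hD₀
    have hr : ∀ z, z ∉ Set.range f → ∃ v, G.IsTwin H z (f v) := fun z hz => by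
      have := (Set.ncard_pos (Set.toFinite _)).1 (lt_of_le_of_lt (Nat.zero_le _) (hmany z hz))
      exact this
    -- The map `ψ` inverts the inclusion on surviving vertices and sends a deleted vertex to a
    -- surviving twin; the new dominating set is the image of `D`.
    have hψ : ∀ y : GlueVertex G F, ∃ x : GlueVertex (G.pullback f) F, glueMap G f F x = y ∨
        ∃ z, z ∉ Set.range f ∧ y = glueLeft G F z ∧
          ∃ v, G.IsTwin H z (f v) ∧ x = glueLeft (G.pullback f) F v := by
      intro y
      rcases glue_cases _ _ y with ⟨u, rfl⟩ | ⟨v, rfl⟩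
      · by_cases hu : u ∈ Set.range f
        · obtain ⟨v, rfl⟩ := hu
          exact ⟨_, Or.inl (glueMap_glueLeft G f F v)⟩
        · obtain ⟨v, hv⟩ := hr u hu
          exact ⟨_, Or.inr ⟨u, hu, rfl, v, hv, rfl⟩⟩
      · exact ⟨_, Or.inl (glueMap_glueRight G f F v)⟩
    choose ψ hψ using hψ
    have hψφ : ∀ x, ψ (glueMap G f F x) = x := fun x => by
      rcases hψ (glueMap G f F x) with h | ⟨z, hz, h, -⟩
      · exact glueMap_injective G f F h
      · exact absurd (mem_range_of_glueMap_eq hS h) hz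
    refine ⟨D.image ψ, ?_, ?_⟩
    · have hmem : ∀ x, glueMap G f F x ∈ D → x ∈ D.image ψ := fun x hx =>
        Finset.mem_image.2 ⟨_, hx, hψφ x⟩
      have hheavy : ∀ w : Fin m, d * G.boundary.card < {v | G.IsTwin H (f w) (f v)}.ncard →
          ∃ u ∈ D.image ψ, (glue (G.pullback f) F).Adj u (glueLeft (G.pullback f) F w) := by
        intro w hw
        obtain ⟨a, haH, haD, hadj⟩ := exists_hub_adj hD hDS hdeg (hw.trans_le (htwin _))
        obtain ⟨a, rfl⟩ := hH a haH
        exact ⟨glueLeft (G.pullback f) F a, hmem _ haD,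
          glue_adj_glueLeft (show G.graph.Adj (f a) (f w) from hadj.symm)⟩
      intro x
      rcases hD (glueMap G f F x) with h | ⟨y, hy, hxy⟩
      · exact Or.inl (hmem x h)
      · right
        rcases hψ y with h | ⟨z, hz, rfl, v, hv, hvx⟩
        · rw [← h] at hxy hy
          exact ⟨_, hmem _ hy, adj_of_glueMap_adj hS hxy⟩
        -- Here `x` was dominated by a deleted `z`. If `x` is in `H`, the substitute twin dominates
        -- it; otherwise it keeps many twins and some chosen vertex of `H` dominates it.
        · obtain ⟨w, hzw, hw⟩ := exists_of_glue_adj_glueLeft (hlow z hz).2 hxy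
          obtain ⟨w, rfl⟩ := mem_range_of_glueMap_eq hS hw
          rw [← glueMap_glueLeft] at hw
          cases glueMap_injective G f F hw
          by_cases hwH : f w ∈ H
          · refine ⟨ψ (glueLeft G F z), Finset.mem_image_of_mem _ hy, ?_⟩
            rw [hvx]
            exact glue_adj_glueLeft
              (show G.graph.Adj (f v) (f w) from (hv.2 _ hwH).1 hzw)
          · exact hheavy w (hnbr z hz (f w) hzw hwH).2
    · have : (D.image ψ).card ≤ D.card := Finset.card_image_le
      omega
  · rintro ⟨D₀, hD₀, hk⟩
    obtain ⟨D, hD, hle, hDS⟩ := exists_isDominatingSet_card_leftPart_le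
      (isDominatingSet_boundary_pullback hG hS) hD₀
    refine ⟨D.image (glueMap G f F), ?_, ?_⟩
    · have hφ : ∀ x, glueMap G f F x ∈ D.image (glueMap G f F) ∨
          ∃ u ∈ D.image (glueMap G f F), (glue G F).Adj u (glueMap G f F x) := by
        intro x
        rcases hD x with h | ⟨y, hy, hxy⟩
        · exact Or.inl (Finset.mem_image_of_mem _ h)
        · exact Or.inr ⟨_, Finset.mem_image_of_mem _ hy, glueMap_adj hxy⟩
      intro y
      rcases glue_cases _ _ y with ⟨z, rfl⟩ | ⟨v, rfl⟩
      · by_cases hz : z ∈ Set.range f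
        · obtain ⟨u, rfl⟩ := hz
          exact hφ (glueLeft (G.pullback f) F u)
        · right
          -- The counting is repeated in the smaller graph with the old hubs. They are not
          -- recomputed from the new degrees; closed neighbourhoods of the others only shrink.
          have hdeg' : ∀ v, v ∉ f ⁻¹' H →
              {u | u = v ∨ (G.pullback f).graph.Adj v u}.ncard ≤ d := by
            intro v hv
            refine le_trans ?_ (hdeg (f v) hv)
            rw [← Set.ncard_image_of_injective _ f.injective]
            refine Set.ncard_le_ncard ?_ (Set.toFinite _)
            rintro _ ⟨u, hu | hu, rfl⟩
            · exact Or.inl (congrArg f hu)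
            · exact Or.inr hu
          have hm := hmany z hz
          rw [Set.ncard_eq_toFinset_card', Set.toFinset_ofPred,
            ← card_boundary_pullback hS] at hm
          obtain ⟨w, hw, hwD, hadj⟩ := exists_hub_of_card_lt hD (f ⁻¹' H) hdeg' hDS
            (Finset.univ.filter fun v => G.IsTwin H z (f v))
            (fun c hc h => (Finset.mem_filter.1 hc).2.1.2 (mem_boundary_pullback.1 h))
            (fun c hc => (Finset.mem_filter.1 hc).2.1.1)
            (fun c hc c' hc' w hw h => ((Finset.mem_filter.1 hc').2.2 (f w) hw).1
              (((Finset.mem_filter.1 hc).2.2 (f w) hw).2 h)) hm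
          obtain ⟨c, hc⟩ := Finset.card_pos.1 (lt_of_le_of_lt (Nat.zero_le _) hm)
          exact ⟨_, Finset.mem_image_of_mem _ hwD, glue_adj_glueLeft
            (((Finset.mem_filter.1 hc).2.2 (f w) hw).2 (hadj c hc)).symm⟩
      · exact hφ (glueRight (G.pullback f) F v)
    · have : (D.image (glueMap G f F)).card ≤ D.card := Finset.card_image_le
      omega

end Reduction

end BoundariedGraph

/-! ### Running-time logic for programs and bounded loops -/

namespace RAM

theorem Memory.write_same (σ : Memory) (a i j m : ℕ) : σ.write a i j m a i j = m := by
  simp [Memory.write]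

theorem Memory.write_array_ne {a b : ℕ} (h : b ≠ a) (σ : Memory) (i j m : ℕ) :
    σ.write a i j m b = σ b := by
  funext i' j'
  simp [Memory.write, h]

theorem Memory.write_cell_ne {i j i' j' : ℕ} (h : ¬ (i' = i ∧ j' = j)) (σ : Memory)
    (a m : ℕ) : σ.write a i j m a i' j' = σ a i' j' := by
  simp [Memory.write, h]

/-- `p` halts from `σ` within `B` steps in a memory that satisfies `Q`. -/
def Runs (p : Program) (σ : Memory) (B : ℕ) (Q : Memory → Prop) : Prop :=
  ∃ T σ', Exec p σ T σ' ∧ T ≤ B ∧ Q σ'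

theorem Runs.assign {σ : Memory} {a : ℕ} {i j e : Expr} {Q : Memory → Prop}
    (h : Q (σ.write a (i.val σ) (j.val σ) (e.val σ))) : Runs (.assign a i j e) σ 1 Q :=
  ⟨1, _, .assign σ a i j e, le_rfl, h⟩

theorem Runs.seq {p q : Program} {σ : Memory} {B C : ℕ} {P Q : Memory → Prop}
    (hp : Runs p σ B P) (hq : ∀ σ', P σ' → Runs q σ' C Q) : Runs (.seq p q) σ (B + C) Q := by
  obtain ⟨T, σ', h, hT, hP⟩ := hp
  obtain ⟨T', σ'', h', hT', hQ⟩ := hq σ' hP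
  exact ⟨_, _, .seq h h', add_le_add hT hT', hQ⟩

theorem Runs.mono {p : Program} {σ : Memory} {B C : ℕ} {P Q : Memory → Prop}
    (hp : Runs p σ B P) (hB : B ≤ C) (hQ : ∀ σ', P σ' → Q σ') : Runs p σ C Q := by
  obtain ⟨T, σ', h, hT, hP⟩ := hp
  exact ⟨T, σ', h, hT.trans hB, hQ _ hP⟩

/-- The content of cell `(0, 0)` of array `x`, as an expression. -/
abbrev scalar (x : ℕ) : Expr := .cell x (.const 0) (.const 0)

/-- Run `body` with cell `(0, 0)` of array `x` ranging over the numbers below the content of cell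
`(0, 0)` of array `0`. -/
def forLoop (x : ℕ) (body : Program) : Program :=
  .seq (.assign x (.const 0) (.const 0) (.const 0))
    (.loop (.sub (scalar 0) (scalar x))
      (.seq body (.assign x (.const 0) (.const 0) (.add (scalar x) (.const 1)))))

/-- Induction on the number of remaining rounds. A round costs the body, one test and one increment;
the additional `2` is the initialization and the failing last test. -/
theorem runs_forLoop {x : ℕ} {body : Program} {n B : ℕ}
    (Inv : ℕ → Memory → Prop) (hwrite : ∀ m σ v, Inv m σ → Inv m (σ.write x 0 0 v))
    (hn : ∀ m σ, Inv m σ → σ 0 0 0 = n)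
    (hbody : ∀ m < n, ∀ σ, σ x 0 0 = m → Inv m σ →
      Runs body σ B fun σ' => σ' x 0 0 = m ∧ Inv (m + 1) σ')
    {σ : Memory} (h : Inv 0 σ) : Runs (forLoop x body) σ (n * (B + 2) + 2) (Inv n) := by
  have key : ∀ k m σ, m + k = n → σ x 0 0 = m → Inv m σ →
      Runs (.loop (.sub (scalar 0) (scalar x))
        (.seq body (.assign x (.const 0) (.const 0) (.add (scalar x) (.const 1)))))
        σ (k * (B + 2) + 1) (Inv n) := by
    intro k
    induction k with
    | zero =>
      intro m σ hm hσ hI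
      obtain rfl : m = n := by omega
      refine ⟨1, σ, .loop_false ?_, by omega, hI⟩
      simp only [Expr.val, hn _ _ hI, hσ, Nat.sub_self]
    | succ k ih =>
      intro m σ hm hσ hI
      have h1 : Runs (.seq body (.assign x (.const 0) (.const 0) (.add (scalar x) (.const 1))))
          σ (B + 1) fun σ' => σ' x 0 0 = m + 1 ∧ Inv (m + 1) σ' :=
        (hbody m (by omega) σ hσ hI).seq fun σ' hσ' => .assign
          ⟨by simp only [Expr.val, Memory.write_same, hσ'.1], hwrite _ _ _ hσ'.2⟩
      obtain ⟨T, σ', hE, hT, hσ', hI'⟩ := h1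
      obtain ⟨T', σ'', hE', hT', hI''⟩ := ih (m + 1) σ' (by omega) hσ' hI'
      refine ⟨1 + T + T', σ'', .loop_true ?_ hE hE', ?_, hI''⟩
      · simp only [Expr.val, hn _ _ hI, hσ]
        omega
      · rw [Nat.succ_mul]
        omega
  refine (Runs.seq (P := fun σ' => σ' x 0 0 = 0 ∧ Inv 0 σ') (.assign ?_)
    fun σ' hσ' => key n 0 σ' (by omega) hσ'.1 hσ'.2).mono (by omega) fun _ => id
  exact ⟨Memory.write_same _ _ _ _ _, hwrite _ _ _ h⟩

/-! ### Array-filling instructions -/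

/-- Expressions in three loop variables. -/
inductive Term where
  | row
  | col
  | idx
  | const (m : ℕ)
  | cell (a : ℕ) (i j : Term)
  | add (e₁ e₂ : Term)
  | sub (e₁ e₂ : Term)

namespace Term

/-- The value for given values of the loop variables. -/
def val (σ : Memory) (i j k : ℕ) : Term → ℕ
  | row => i
  | col => j
  | idx => k
  | const m => m
  | cell a x y => σ a (x.val σ i j k) (y.val σ i j k)
  | add e₁ e₂ => e₁.val σ i j k + e₂.val σ i j k
  | sub e₁ e₂ => e₁.val σ i j k - e₂.val σ i j k

/-- The loop variables are kept in arrays `100`, `101` and `102`. -/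
def compile : Term → Expr
  | row => scalar 100
  | col => scalar 101
  | idx => scalar 102
  | const m => .const m
  | cell a x y => .cell a x.compile y.compile
  | add e₁ e₂ => .add e₁.compile e₂.compile
  | sub e₁ e₂ => .sub e₁.compile e₂.compile

/-- All arrays mentioned satisfy `P`. -/
def Reads (P : ℕ → Prop) : Term → Prop
  | cell a x y => P a ∧ x.Reads P ∧ y.Reads P
  | add e₁ e₂ => e₁.Reads P ∧ e₂.Reads P
  | sub e₁ e₂ => e₁.Reads P ∧ e₂.Reads P
  | _ => True

theorem val_congr {P : ℕ → Prop} {σ τ : Memory} (h : ∀ a, P a → σ a = τ a) (i j k : ℕ) :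
    ∀ e : Term, e.Reads P → e.val σ i j k = e.val τ i j k
  | row, _ | col, _ | idx, _ | const _, _ => rfl
  | cell a x y, he => by
    simp only [val, h a he.1, val_congr h i j k x he.2.1, val_congr h i j k y he.2.2]
  | add x y, he | sub x y, he => by
    simp only [val, val_congr h i j k x he.1, val_congr h i j k y he.2]

/-- Allows code running in the current memory `σ` to be evaluated in a reference memory `τ` that
agrees on the arrays being read. -/
theorem val_compile {P : ℕ → Prop} {σ τ : Memory} (h : ∀ a, P a → σ a = τ a) {i j k : ℕ}
    (hi : σ 100 0 0 = i) (hj : σ 101 0 0 = j) (hk : σ 102 0 0 = k) :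
    ∀ e : Term, e.Reads P → e.compile.val σ = e.val τ i j k
  | row, _ => hi
  | col, _ => hj
  | idx, _ => hk
  | const _, _ => rfl
  | cell a x y, he => by
    simp only [val, compile, Expr.val, h a he.1, val_compile h hi hj hk x he.2.1,
      val_compile h hi hj hk y he.2.2]
  | add x y, he | sub x y, he => by
    simp only [val, compile, Expr.val, val_compile h hi hj hk x he.1,
      val_compile h hi hj hk y he.2]

/-- `m * e`. -/
def nsmul (e : Term) : ℕ → Term
  | 0 => const 0
  | m + 1 => add (e.nsmul m) e

theorem val_nsmul (σ : Memory) (i j k : ℕ) (e : Term) (m : ℕ) :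
    (e.nsmul m).val σ i j k = m * e.val σ i j k := by
  induction m with
  | zero => simp [nsmul, val]
  | succ m ih => simp [nsmul, val, ih, Nat.succ_mul]

theorem reads_nsmul {P : ℕ → Prop} {e : Term} (h : e.Reads P) (m : ℕ) :
    (e.nsmul m).Reads P := by
  induction m with
  | zero => trivial
  | succ m ih => exact ⟨ih, h⟩

end Term

/-- The instruction to set the cells `(i, j)` of the array `target` to
`start(i, j, 0) + ∑ k, summand(i, j, k)`, where all indices range over the numbers below `n`. -/
structure Fill where
  target : ℕ
  start : Term
  summand : Term

namespace Fill

/-- The value that is written to cell `(i, j)`, evaluated in memory `σ`. -/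
def value (I : Fill) (σ : Memory) (n i j : ℕ) : ℕ :=
  I.start.val σ i j 0 + ∑ k ∈ Finset.range n, I.summand.val σ i j k

/-- The program that carries out the instruction. -/
def program (I : Fill) : Program :=
  forLoop 100 <| forLoop 101 <|
    .seq (.assign 102 (.const 0) (.const 0) (.const 0)) <|
    .seq (.assign I.target (scalar 100) (scalar 101) I.start.compile) <|
    forLoop 102 (.assign I.target (scalar 100) (scalar 101)
      (.add (.cell I.target (scalar 100) (scalar 101)) I.summand.compile))

/-- A bound for the number of steps. -/
def time (n : ℕ) : ℕ := n * (n * (n * 3 + 6) + 4) + 2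

/-- The target is not array `0` or a loop variable, and the terms read neither the target nor the
loop variables through an array. -/
structure WellFormed (I : Fill) : Prop where
  pos : I.target ≠ 0
  lt : I.target < 100
  start : I.start.Reads fun a => a ≠ I.target ∧ a < 100
  summand : I.summand.Reads fun a => a ≠ I.target ∧ a < 100

theorem wellFormed_iff {I : Fill} : I.WellFormed ↔ I.target ≠ 0 ∧ I.target < 100 ∧
    I.start.Reads (fun a => a ≠ I.target ∧ a < 100) ∧
    I.summand.Reads fun a => a ≠ I.target ∧ a < 100 :=
  ⟨fun ⟨h₁, h₂, h₃, h₄⟩ => ⟨h₁, h₂, h₃, h₄⟩, fun ⟨h₁, h₂, h₃, h₄⟩ => ⟨h₁, h₂, h₃, h₄⟩⟩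

/-- Three nested invariants: earlier rows are final, earlier cells of the current row are final, and
the current cell holds a partial sum. Nothing that the terms read is changed, so they can be
evaluated in the initial memory throughout. -/
theorem runs_program {I : Fill} (hI : I.WellFormed) {σ : Memory} {n : ℕ} (hn : σ 0 0 0 = n) :
    Runs I.program σ (time n) fun σ' =>
      (∀ b, b ≠ I.target ∧ b < 100 → σ' b = σ b) ∧
      ∀ i < n, ∀ j < n, σ' I.target i j = I.value σ n i j := by
  obtain ⟨a, e₀, e⟩ := I
  obtain ⟨h0, hlt, he₀, he⟩ := hI
  dsimp only at h0 hlt he₀ he ⊢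
  set v := Fill.value ⟨a, e₀, e⟩ σ n with hv
  set A : Memory → Prop := fun τ => ∀ b, b ≠ a ∧ b < 100 → τ b = σ b with hA
  have hAn : ∀ τ, A τ → τ 0 0 0 = n := fun τ h => by rw [h 0 ⟨h0.symm, by omega⟩, hn]
  have hAw : ∀ τ, A τ → ∀ x i j m, (100 ≤ x ∨ x = a) → A (τ.write x i j m) :=
    fun τ h x i j m hx b hb => by
      rw [Memory.write_array_ne (by rcases hb with ⟨h1, h2⟩; omega), h b hb]
  have hinner : ∀ i < n, ∀ j < n, ∀ τ : Memory, A τ → τ 100 0 0 = i → τ 101 0 0 = j →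
      (∀ i' < i, ∀ j' < n, τ a i' j' = v i' j') → (∀ j' < j, τ a i j' = v i j') →
      Runs (.seq (.assign 102 (.const 0) (.const 0) (.const 0)) <|
        .seq (.assign a (scalar 100) (scalar 101) e₀.compile) <|
        forLoop 102 (.assign a (scalar 100) (scalar 101)
          (.add (.cell a (scalar 100) (scalar 101)) e.compile))) τ (n * 3 + 4) fun τ =>
        τ 101 0 0 = j ∧ A τ ∧ τ 100 0 0 = i ∧
          (∀ i' < i, ∀ j' < n, τ a i' j' = v i' j') ∧ (∀ j' < j + 1, τ a i j' = v i j') := by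
    intro i hi j hj τ hτ h100 h101 hrow hcol
    -- The index variable is reset first because `Fill.value` evaluates the start term at index `0`.
    refine (Runs.seq (P := fun τ => A τ ∧ τ 100 0 0 = i ∧ τ 101 0 0 = j ∧ τ 102 0 0 = 0 ∧
      (∀ i' < i, ∀ j' < n, τ a i' j' = v i' j') ∧ (∀ j' < j, τ a i j' = v i j')) (.assign ?_)
      fun τ hτ => Runs.seq (P := fun τ => A τ ∧ τ 100 0 0 = i ∧ τ 101 0 0 = j ∧
        (∀ i' < i, ∀ j' < n, τ a i' j' = v i' j') ∧ (∀ j' < j, τ a i j' = v i j') ∧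
        τ a i j = e₀.val σ i j 0) (.assign ?_)
        fun τ hτ => (runs_forLoop (n := n) (B := 1) (fun m τ => A τ ∧
          τ 100 0 0 = i ∧ τ 101 0 0 = j ∧
          (∀ i' < i, ∀ j' < n, τ a i' j' = v i' j') ∧ (∀ j' < j, τ a i j' = v i j') ∧
          τ a i j = e₀.val σ i j 0 + ∑ k ∈ Finset.range m, e.val σ i j k)
          ?_ (fun _ τ h => hAn τ h.1) ?_ (σ := τ) ?_)).mono (by omega) ?_
    · simp only [Expr.val]
      refine ⟨hAw _ hτ _ _ _ _ (by omega), ?_, ?_, Memory.write_same _ _ _ _ _, ?_, ?_⟩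
      · rwa [Memory.write_array_ne (by omega)]
      · rwa [Memory.write_array_ne (by omega)]
      · rwa [Memory.write_array_ne (by omega)]
      · rwa [Memory.write_array_ne (by omega)]
    · obtain ⟨hτ, h100, h101, h102, hrow, hcol⟩ := hτ
      simp only [Expr.val, h100, h101, Term.val_compile hτ h100 h101 h102 _ he₀]
      refine ⟨hAw _ hτ _ _ _ _ (by omega), ?_, ?_, fun i' hi' j' hj' => ?_, fun j' hj' => ?_,
        Memory.write_same _ _ _ _ _⟩
      · rwa [Memory.write_array_ne (by omega)]
      · rwa [Memory.write_array_ne (by omega)]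
      · rw [Memory.write_cell_ne (by omega), hrow i' hi' j' hj']
      · rw [Memory.write_cell_ne (by omega), hcol j' hj']
    · rintro m τ w ⟨hτ, h⟩
      refine ⟨hAw _ hτ _ _ _ _ (by omega), ?_⟩
      rwa [Memory.write_array_ne (by omega), Memory.write_array_ne (by omega),
        Memory.write_array_ne (by omega)]
    · rintro m hm τ h102 ⟨hτ, h100, h101, hrow, hcol, hval⟩
      refine .assign ?_
      simp only [Expr.val, h100, h101, Term.val_compile hτ h100 h101 h102 _ he]
      refine ⟨?_, hAw _ hτ _ _ _ _ (by omega), ?_, ?_, fun i' hi' j' hj' => ?_,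
        fun j' hj' => ?_, ?_⟩
      · rwa [Memory.write_array_ne (by omega)]
      · rwa [Memory.write_array_ne (by omega)]
      · rwa [Memory.write_array_ne (by omega)]
      · rw [Memory.write_cell_ne (by omega), hrow i' hi' j' hj']
      · rw [Memory.write_cell_ne (by omega), hcol j' hj']
      · rw [Memory.write_same, hval, Finset.sum_range_succ, add_assoc]
    · simpa using hτ
    · rintro τ ⟨hτ, h100, h101, hrow, hcol, hval⟩
      refine ⟨h101, hτ, h100, hrow, fun j' hj' => ?_⟩
      rcases Nat.lt_succ_iff_lt_or_eq.1 hj' with h | rfl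
      · exact hcol j' h
      · exact hval
  refine (runs_forLoop (n := n)
    (fun m τ => A τ ∧ ∀ i < m, ∀ j < n, τ a i j = v i j) ?_ (fun _ τ h => hAn τ h.1) ?_
    ⟨fun _ _ => rfl, fun i hi => by omega⟩).mono (B := n * ((n * (n * 3 + 4 + 2) + 2) + 2) + 2)
    (le_of_eq (by rw [time])) fun _ => id
  · rintro m τ w ⟨hτ, h⟩
    refine ⟨hAw _ hτ _ _ _ _ (by omega), ?_⟩
    rwa [Memory.write_array_ne (by omega)]
  · rintro i hi τ h100 ⟨hτ, hrow⟩
    refine (runs_forLoop (n := n)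
      (fun m τ => A τ ∧ τ 100 0 0 = i ∧ (∀ i' < i, ∀ j' < n, τ a i' j' = v i' j') ∧
        ∀ j' < m, τ a i j' = v i j') ?_ (fun _ τ h => hAn τ h.1) ?_
      ⟨hτ, h100, hrow, fun j hj => by omega⟩).mono le_rfl ?_
    · rintro m τ w ⟨hτ, h⟩
      refine ⟨hAw _ hτ _ _ _ _ (by omega), ?_⟩
      rwa [Memory.write_array_ne (by omega), Memory.write_array_ne (by omega)]
    · rintro j hj τ h101 ⟨hτ, h100, hrow, hcol⟩
      exact hinner i hi j hj τ hτ h100 h101 hrow hcol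
    · rintro τ ⟨hτ, h100, hrow, hcol⟩
      refine ⟨h100, hτ, fun i' hi' j' hj' => ?_⟩
      rcases Nat.lt_succ_iff_lt_or_eq.1 hi' with h | rfl
      · exact hrow i' h j' hj'
      · exact hcol j' hj'

/-- The instructions can be carried out one after the other without invalidating an earlier
one: nothing that an instruction has read or written is overwritten later. -/
def Ordered : List Fill → Prop
  | [] => True
  | I :: l => I.WellFormed ∧ (∀ J ∈ l, J.target ≠ I.target ∧
      I.start.Reads (· ≠ J.target) ∧ I.summand.Reads (· ≠ J.target)) ∧ Ordered l

/-- Carry out a list of instructions. -/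
def run : List Fill → Program
  | [] => .skip
  | I :: l => .seq I.program (run l)

end Fill

theorem Term.Reads.and {P Q : ℕ → Prop} : ∀ {e : Term}, e.Reads P → e.Reads Q →
    e.Reads fun a => P a ∧ Q a
  | row, _, _ | col, _, _ | idx, _, _ | const _, _, _ => trivial
  | cell _ _ _, h, h' => ⟨⟨h.1, h'.1⟩, h.2.1.and h'.2.1, h.2.2.and h'.2.2⟩
  | add _ _, h, h' | sub _ _, h, h' => ⟨h.1.and h'.1, h.2.and h'.2⟩

theorem Term.Reads.mono {P Q : ℕ → Prop} (hPQ : ∀ a, P a → Q a) :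
    ∀ {e : Term}, e.Reads P → e.Reads Q
  | row, _ | col, _ | idx, _ | const _, _ => trivial
  | cell _ _ _, h => ⟨hPQ _ h.1, h.2.1.mono hPQ, h.2.2.mono hPQ⟩
  | add _ _, h | sub _ _, h => ⟨h.1.mono hPQ, h.2.mono hPQ⟩

/-- Merges the conditions of `Fill.Ordered`, one for each later instruction, into the single
predicate that `Term.val_congr` expects. -/
theorem Term.Reads.forall_mem {ι : Type*} {l : List ι} {P : ι → ℕ → Prop} {e : Term}
    (h : ∀ x ∈ l, e.Reads (P x)) : e.Reads fun a => ∀ x ∈ l, P x a := by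
  induction l with
  | nil =>
    clear h
    induction e <;> simp_all [Reads]
  | cons x l ih =>
    refine ((h x (by simp)).and (ih fun y hy => h y (by simp [hy]))).mono ?_
    simp

/-- In the final memory, all the equations expressed by the instructions hold. -/
theorem Fill.runs_run {l : List Fill} (hl : Fill.Ordered l) {σ : Memory} {n : ℕ}
    (hn : σ 0 0 0 = n) :
    Runs (Fill.run l) σ (l.length * Fill.time n + 1) fun σ' =>
      (∀ b < 100, (∀ I ∈ l, b ≠ I.target) → σ' b = σ b) ∧
      ∀ I ∈ l, ∀ i < n, ∀ j < n, σ' I.target i j = I.value σ' n i j := by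
  induction l generalizing σ with
  | nil => exact ⟨1, σ, .skip σ, by simp, by simp⟩
  | cons I l ih =>
    obtain ⟨hI, hJ, hl⟩ := hl
    refine ((Fill.runs_program hI hn).seq (C := l.length * Fill.time n + 1) fun τ hτ =>
      (ih hl ?_).mono le_rfl ?_).mono (by rw [List.length_cons]; linarith) fun _ => id
    · rw [hτ.1 0 ⟨hI.pos.symm, by omega⟩, hn]
    · rintro σ' ⟨hb, hv⟩
      refine ⟨fun b hlt hne => ?_, fun J hJl => ?_⟩
      · rw [hb b hlt fun J hJ => hne J (by simp [hJ]), hτ.1 b ⟨hne I (by simp), hlt⟩]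
      · rcases List.mem_cons.1 hJl with rfl | hJl
        · intro i hi j hj
          rw [hb _ hI.lt fun I' hI' => (hJ I' hI').1.symm, hτ.2 i hi j hj]
          -- Neither this instruction nor a later one overwrites what the terms read, so its
          -- equation passes from the initial to the final memory.
          have hcongr : ∀ e : Term, e.Reads (fun a => a ≠ J.target ∧ a < 100) →
              (∀ K ∈ l, e.Reads (· ≠ K.target)) → ∀ k, e.val σ i j k = e.val σ' i j k := by
            intro e h1 h2 k
            refine Term.val_congr ?_ i j k e (h1.and (Term.Reads.forall_mem h2))
            rintro a ⟨h3, h4⟩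
            rw [hb a h3.2 h4, hτ.1 a h3]
          rw [Fill.value, Fill.value, hcongr _ hI.start fun K hK => (hJ K hK).2.1]
          congr 1
          exact Finset.sum_congr rfl fun k _ => hcongr _ hI.summand (fun K hK => (hJ K hK).2.2) k
        · exact hv J hJl

end RAM

/-! ### The kept vertices: many twins survive, and their number is linear -/

namespace BoundariedGraph

variable {t : ℕ}

theorem IsTwin.isTwin_iff {G : BoundariedGraph t} {H : Set (Fin G.n)} {u v w : Fin G.n}
    (h : G.IsTwin H u v) : G.IsTwin H u w ↔ G.IsTwin H v w := by
  constructor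
  · exact fun h' => ⟨h'.1, fun x hx => (h.2 x hx).symm.trans (h'.2 x hx)⟩
  · exact fun h' => ⟨h'.1, fun x hx => (h.2 x hx).trans (h'.2 x hx)⟩

/-- The number of twins of `z` that precede `z`. -/
noncomputable def rank (G : BoundariedGraph t) (H : Set (Fin G.n)) (z : Fin G.n) : ℕ :=
  {v | v < z ∧ G.IsTwin H z v}.ncard

/-- A low vertex with more than `M` twins. -/
def IsHeavy (G : BoundariedGraph t) (H : Set (Fin G.n)) (M : ℕ) (w : Fin G.n) : Prop :=
  G.IsLow H w ∧ M < {v | G.IsTwin H w v}.ncard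

/-- The vertices that are not deleted by the kernelization. -/
def IsKept (G : BoundariedGraph t) (H : Set (Fin G.n)) (M : ℕ) (z : Fin G.n) : Prop :=
  ¬ (G.IsLow H z ∧ M < G.rank H z ∧ ∀ w, G.graph.Adj z w → w ∈ H ∨ G.IsHeavy H M w)

section Kernel

variable {G : BoundariedGraph t} {H : Set (Fin G.n)} {M : ℕ}

/-- `z` itself is counted for `z'` but not for `z`. Thus ranks tell the members of a twin class
apart. -/
theorem rank_lt_rank {z z' : Fin G.n} (hz : G.IsLow H z) (h : G.IsTwin H z z') (hlt : z < z') :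
    G.rank H z < G.rank H z' := by
  refine Set.ncard_lt_ncard ?_ (Set.toFinite _)
  rw [Set.ssubset_iff_of_subset]
  · exact ⟨z, ⟨hlt, h.isTwin_iff.1 ⟨hz, fun _ _ => Iff.rfl⟩⟩, fun h => lt_irrefl _ h.1⟩
  · exact fun v hv => ⟨hv.1.trans hlt, h.isTwin_iff.1 hv.2⟩

/-- If some twin is deleted, consider the least such one: more than `M` twins precede it, and by
minimality all of these are kept. -/
theorem lt_ncard_isTwin_isKept {u : Fin G.n} (h : M < {v | G.IsTwin H u v}.ncard) :
    M < {v | G.IsTwin H u v ∧ G.IsKept H M v}.ncard := by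
  by_cases hall : ∀ v, G.IsTwin H u v → G.IsKept H M v
  · refine h.trans_le (Set.ncard_le_ncard ?_ (Set.toFinite _))
    exact fun v hv => ⟨hv, hall v hv⟩
  push Not at hall
  obtain ⟨v, ⟨huv, hv⟩, hmin⟩ := WellFounded.has_min
    (wellFounded_lt (α := Fin G.n)) {v | G.IsTwin H u v ∧ ¬ G.IsKept H M v} hall
  refine (not_not.1 hv).2.1.trans_le (Set.ncard_le_ncard ?_ (Set.toFinite _))
  rintro w ⟨hlt, hw⟩
  have huw := huv.isTwin_iff.2 hw
  exact ⟨huw, by_contra fun hn => hmin w ⟨huw, hn⟩ hlt⟩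

/-- A low vertex is determined by its neighbourhood in `H` together with its rank. -/
theorem ncard_isLow_rank_le :
    {z | G.IsLow H z ∧ G.rank H z ≤ M}.ncard ≤ 2 ^ H.ncard * (M + 1) := by
  classical
  have hcard : (H.toFinset.powerset ×ˢ Finset.range (M + 1)).card = 2 ^ H.ncard * (M + 1) := by
    rw [Finset.card_product, Finset.card_powerset, Finset.card_range,
      Set.ncard_eq_toFinset_card']
  rw [← hcard, Set.ncard_eq_toFinset_card']
  refine Finset.card_le_card_of_injOn
    (fun z => (H.toFinset.filter (G.graph.Adj z), G.rank H z)) ?_ ?_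
  · intro z hz
    rw [Set.coe_toFinset] at hz
    simp only [Finset.coe_product, Set.mem_prod, Finset.mem_coe, Finset.mem_powerset,
      Finset.mem_range]
    exact ⟨Finset.filter_subset _ _, Nat.lt_succ_of_le hz.2⟩
  · intro z hz z' hz' heq
    rw [Set.coe_toFinset] at hz hz'
    obtain ⟨h1, h2⟩ := Prod.mk.inj heq
    have h3 : ∀ w ∈ H, G.graph.Adj z w ↔ G.graph.Adj z' w := fun w hw => by
      have := Finset.ext_iff.1 h1 w
      simpa [hw] using this
    rcases lt_trichotomy z z' with h | h | h
    · exact absurd h2 (rank_lt_rank hz.1 ⟨hz'.1, h3⟩ h).ne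
    · exact h
    · exact absurd h2.symm (rank_lt_rank hz'.1 ⟨hz.1, fun w hw => (h3 w hw).symm⟩ h).ne

theorem rank_le_ncard_isTwin (z : Fin G.n) : G.rank H z ≤ {v | G.IsTwin H z v}.ncard :=
  Set.ncard_le_ncard (fun _ hv => hv.2) (Set.toFinite _)

/-- A kept low vertex of rank above `M` has a neighbour outside `H` that is not heavy. Such a
neighbour is a boundary vertex or has rank at most `M`, so it lies in the small set `Q` of vertices
of degree at most `d`. -/
theorem ncard_isKept_le {d : ℕ} (hdeg : ∀ v, v ∉ H → (G.graph.neighborSet v).ncard ≤ d) :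
    {z | G.IsKept H M z}.ncard ≤ H.ncard + G.boundary.card + 2 ^ H.ncard * (M + 1) +
      (G.boundary.card + 2 ^ H.ncard * (M + 1)) * d := by
  classical
  set P := {z | G.IsLow H z ∧ G.rank H z ≤ M} with hP
  have hPcard : P.toFinset.card ≤ 2 ^ H.ncard * (M + 1) := by
    rw [← Set.ncard_eq_toFinset_card']
    exact ncard_isLow_rank_le
  set Q := (G.boundary ∪ P.toFinset).filter (· ∉ H) with hQ
  have hQcard : Q.card ≤ G.boundary.card + 2 ^ H.ncard * (M + 1) :=
    (Finset.card_filter_le _ _).trans ((Finset.card_union_le _ _).trans (by omega))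
  have hsub : {z | G.IsKept H M z}.toFinset ⊆ H.toFinset ∪ G.boundary ∪ P.toFinset ∪
      Q.biUnion fun w => (G.graph.neighborSet w).toFinset := by
    intro z hz
    rw [Set.mem_toFinset] at hz
    simp only [Finset.mem_union, Set.mem_toFinset, Finset.mem_biUnion, hQ, Finset.mem_filter]
    by_contra hcon
    push Not at hcon
    obtain ⟨⟨⟨hzH, hzS⟩, hzP⟩, hzN⟩ := hcon
    have hlow : G.IsLow H z := ⟨hzH, hzS⟩
    refine hz ⟨hlow, not_le.1 fun h => hzP ⟨hlow, h⟩, fun w hw => ?_⟩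
    by_contra hn
    push Not at hn
    obtain ⟨hwH, hwh⟩ := hn
    refine hzN w ⟨?_, hwH⟩ hw.symm
    by_cases hwS : w ∈ G.boundary
    · exact Or.inl hwS
    · refine Or.inr ⟨⟨hwH, hwS⟩, not_lt.1 fun h => hwh ⟨⟨hwH, hwS⟩, ?_⟩⟩
      exact h.trans_le (rank_le_ncard_isTwin w)
  have hbi := Finset.card_biUnion_le_card_mul Q
    (fun w => (G.graph.neighborSet w).toFinset) d fun w hw => by
      rw [← Set.ncard_eq_toFinset_card']
      exact hdeg w (Finset.mem_filter.1 hw).2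
  have hmul := Nat.mul_le_mul_right d hQcard
  rw [Set.ncard_eq_toFinset_card', Set.ncard_eq_toFinset_card' H]
  rw [Set.ncard_eq_toFinset_card' H] at hPcard hQcard hmul
  have h1 := Finset.card_le_card hsub
  have h2 := Finset.card_union_le (H.toFinset ∪ G.boundary ∪ P.toFinset)
    (Q.biUnion fun w => (G.graph.neighborSet w).toFinset)
  have h3 := Finset.card_union_le (H.toFinset ∪ G.boundary) P.toFinset
  have h4 := Finset.card_union_le H.toFinset G.boundary
  omega

end Kernel

/-- The vertices of degree at least `h`. -/
def hubs (G : BoundariedGraph t) (h : ℕ) : Set (Fin G.n) :=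
  {v | h ≤ (G.graph.neighborSet v).ncard}

/-- Restricting to the kept vertices preserves the behaviour with respect to dominating sets. -/
theorem isTranspositionConstant_pullback_isKept {G : BoundariedGraph t} {h m : ℕ}
    (hG : IsDominatingSet G.graph G.boundary) (f : Fin m ↪ Fin G.n)
    (hf : ∀ z, z ∈ Set.range f ↔ G.IsKept (G.hubs h) (h * G.boundary.card) z) :
    IsTranspositionConstant DS G (G.pullback f) 0 := by
  have hmany : ∀ z, h * G.boundary.card < {v | G.IsTwin (G.hubs h) z v}.ncard →
      h * G.boundary.card < {v | G.IsTwin (G.hubs h) z (f v)}.ncard := fun z hz => by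
    refine (lt_ncard_isTwin_isKept hz).trans_le ?_
    rw [← Set.ncard_image_of_injective _ f.injective]
    refine Set.ncard_le_ncard ?_ (Set.toFinite _)
    rintro v ⟨hv, hk⟩
    obtain ⟨v, rfl⟩ := (hf v).2 hk
    exact ⟨v, hv, rfl⟩
  have hdel : ∀ z, z ∉ Set.range f → G.IsLow (G.hubs h) z ∧
      h * G.boundary.card < G.rank (G.hubs h) z ∧ ∀ w, G.graph.Adj z w →
        w ∈ G.hubs h ∨ G.IsHeavy (G.hubs h) (h * G.boundary.card) w :=
    fun z hz => not_not.1 fun hn => hz ((hf z).2 hn)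
  refine isTranspositionConstant_pullback (H := G.hubs h) (d := h) hG ?_
    (fun z hz => (hdel z hz).1) (fun z hz => hmany z ?_) fun z hz w hzw hw => ?_
  · intro v hv
    have h1 : {u | u = v ∨ G.graph.Adj v u} = insert v (G.graph.neighborSet v) := by
      ext u
      simp
    have h2 := Set.ncard_insert_le v (G.graph.neighborSet v)
    have h3 : ¬ h ≤ (G.graph.neighborSet v).ncard := hv
    rw [h1]
    omega
  · exact (hdel z hz).2.1.trans_le (rank_le_ncard_isTwin z)
  · have := ((hdel z hz).2.2 w hzw).resolve_left hw
    exact ⟨this.1.2, hmany w this.2⟩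

/-- The number of kept vertices is linear in the size of the boundary. -/
theorem ncard_isKept_hubs_le {G : BoundariedGraph t} {h : ℕ} (hpos : 0 < G.boundary.card)
    (hhubs : (G.hubs h).ncard ≤ h) :
    {z | G.IsKept (G.hubs h) (h * G.boundary.card) z}.ncard ≤
      (h + 1 + 2 ^ h * (h + 1) + (1 + 2 ^ h * (h + 1)) * h) * G.boundary.card := by
  refine (ncard_isKept_le (H := G.hubs h) (d := h) fun v hv => (not_le.1 hv).le).trans ?_
  set s := G.boundary.card
  have h1 : 2 ^ (G.hubs h).ncard ≤ 2 ^ h := Nat.pow_le_pow_right (by omega) hhubs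
  -- A nonempty boundary lets the additive constants be absorbed into multiples of `s`.
  have h2 : 2 ^ (G.hubs h).ncard * (h * s + 1) ≤ 2 ^ h * ((h + 1) * s) :=
    Nat.mul_le_mul h1 (by linarith)
  have h3 := Nat.mul_le_mul_right h (Nat.add_le_add_left h2 s)
  have h4 : h ≤ h * s := Nat.le_mul_of_pos_right h hpos
  calc _ ≤ h * s + s + 2 ^ h * ((h + 1) * s) + (s + 2 ^ h * ((h + 1) * s)) * h := by omega
    _ = _ := by ring

theorem IsTranspositionConstant.symm_zero {G G' : BoundariedGraph t}
    (h : IsTranspositionConstant DS G G' 0) : IsTranspositionConstant DS G' G 0 := fun F k => by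
  have := h F k
  rw [add_zero] at this ⊢
  exact this.symm

end BoundariedGraph

/-! ### The kernelization program -/

namespace RAM

open Term in
/-- The instructions that compute the kept vertices; arrays `10` to `21` contain, in turn: degree,
membership in the set of hubs, size of the boundary, lowness, number of hubs that separate two
vertices, rank, number of twins, heaviness, number of neighbours that are neither hubs nor heavy,
whether a vertex is kept, number of kept vertices up to a vertex, and position of the `i`-th kept
vertex.  Arrays `22` to `24` contain the number of kept vertices, and the adjacency matrix and the
labels of the kernel. -/
def kernelFills (h : ℕ) : List Fill :=
  let at' (a : ℕ) (x : Term) : Term := cell a x x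
  let isS (x : Term) : Term := sub (const 1) (sub (const 1) (cell 2 x (const 0)))
  let bound (x : Term) : Term := add ((at' 12 x).nsmul h) (const 1)
  let twin : Term := sub (at' 13 idx) (cell 14 row idx)
  [ ⟨10, const 0, cell 1 row idx⟩,
    ⟨11, sub (const 1) (sub (const h) (at' 10 row)), const 0⟩,
    ⟨12, const 0, isS idx⟩,
    ⟨13, sub (const 1) (add (at' 11 row) (isS row)), const 0⟩,
    ⟨14, const 0, sub (add (add (sub (cell 1 row idx) (cell 1 col idx))
      (sub (cell 1 col idx) (cell 1 row idx))) (at' 11 idx)) (const 1)⟩,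
    ⟨15, const 0, sub twin (sub (add idx (const 1)) col)⟩,
    ⟨16, const 0, twin⟩,
    ⟨17, sub (at' 13 row) (sub (bound row) (at' 16 row)), const 0⟩,
    ⟨18, const 0, sub (cell 1 row idx) (add (at' 11 idx) (at' 17 idx))⟩,
    ⟨19, sub (const 1) (sub (sub (at' 13 row) (sub (bound row) (at' 15 row))) (at' 18 row)),
      const 0⟩,
    ⟨20, const 0, sub (at' 19 idx) (sub idx row)⟩,
    ⟨21, const 0, sub (const 1) (sub (at' 20 idx) row)⟩,
    ⟨22, const 0, at' 19 idx⟩,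
    ⟨23, cell 1 (at' 21 row) (at' 21 col), const 0⟩,
    ⟨24, cell 2 (at' 21 row) (const 0), const 0⟩ ]

theorem ordered_kernelFills (h : ℕ) : Fill.Ordered (kernelFills h) := by
  -- For `h = 0` the multiple is a constant and reads no array.
  have hs : ∀ {P : ℕ → Prop} {e : Term}, (e.nsmul h).Reads P ↔ h = 0 ∨ e.Reads P := by
    intro P e
    cases h with
    | zero => simp [Term.nsmul, Term.Reads]
    | succ m =>
      simp only [Nat.add_eq_zero_iff, one_ne_zero, and_false, false_or]
      exact ⟨fun h => h.2, fun h => Term.reads_nsmul h _⟩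
  simp [kernelFills, Fill.Ordered, Fill.wellFormed_iff, Term.Reads, hs]

theorem sum_ite_eq_ncard {n : ℕ} (p : Fin n → Prop) [DecidablePred p] :
    (∑ k : Fin n, if p k then 1 else 0) = {k | p k}.ncard := by
  rw [Finset.sum_boole, Set.ncard_eq_toFinset_card', Set.toFinset_ofPred, Nat.cast_id]

/-- Whether a number is a kept vertex. -/
def KeptIndex {t : ℕ} (G : BoundariedGraph t) (h z : ℕ) : Prop :=
  ∃ hz : z < G.n, G.IsKept (G.hubs h) (h * G.boundary.card) ⟨z, hz⟩

open Classical in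
-- Truncated subtraction encodes the logic: `1 - x` negates, `a - b` is zero exactly when `a ≤ b`,
-- and a universal statement says that a sum of violations vanishes. Each array is identified from
-- the earlier ones through its defining equation.
theorem kernelFills_spec {t : ℕ} {G : BoundariedGraph t} {h : ℕ} {σ : Memory}
    (hadj : ∀ u v : Fin G.n, σ 1 u v = if G.graph.Adj u v then 1 else 0)
    (hlab : ∀ v : Fin G.n, 1 - (1 - σ 2 v 0) = if v ∈ G.boundary then 1 else 0)
    (hfill : ∀ I ∈ kernelFills h, ∀ i < G.n, ∀ j < G.n, σ I.target i j = I.value σ G.n i j) :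
    (∀ i < G.n, ∀ j < G.n, σ 22 i j = Nat.count (KeptIndex G h) G.n) ∧
    (∀ i < Nat.count (KeptIndex G h) G.n, ∀ j < Nat.count (KeptIndex G h) G.n,
      σ 23 i j = σ 1 (Nat.nth (KeptIndex G h) i) (Nat.nth (KeptIndex G h) j)) ∧
    ∀ i < Nat.count (KeptIndex G h) G.n, ∀ j < Nat.count (KeptIndex G h) G.n,
      σ 24 i j = σ 2 (Nat.nth (KeptIndex G h) i) 0 := by
  set n := G.n with hn
  set H := G.hubs h with hH
  set M := h * G.boundary.card with hM
  set κ := KeptIndex G h with hκ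
  have hfin : ∀ I ∈ kernelFills h, ∀ u v : Fin n, σ I.target u v =
      I.start.val σ u v 0 + ∑ k : Fin n, I.summand.val σ u v k := fun I hI u v => by
    rw [hfill I hI u u.2 v v.2, Fill.value, Finset.sum_range]
  simp only [kernelFills, List.forall_mem_cons, Term.val, Term.val_nsmul, zero_add,
    Finset.sum_const_zero, add_zero] at hfin
  obtain ⟨f10, f11, f12, f13, f14, f15, f16, f17, f18, f19, f20, f21, f22, f23, f24, -⟩ := hfin
  have hdeg : ∀ u v : Fin n, σ 10 u v = (G.graph.neighborSet u).ncard := fun u v => by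
    rw [f10]
    simp only [hadj]
    rw [sum_ite_eq_ncard]
    rfl
  have hhub : ∀ u v : Fin n, σ 11 u v = if u ∈ H then 1 else 0 := fun u v => by
    rw [f11, hdeg]
    have : u ∈ H ↔ h ≤ (G.graph.neighborSet u).ncard := Iff.rfl
    simp only [this]
    split_ifs <;> omega
  have hbd : ∀ u v : Fin n, σ 12 u v = G.boundary.card := fun u v => by
    rw [f12]
    simp only [hlab]
    simp
  have hlow : ∀ u v : Fin n, σ 13 u v = if G.IsLow H u then 1 else 0 := fun u v => by
    rw [f13, hhub, hlab]
    simp only [BoundariedGraph.IsLow]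
    by_cases h1 : u ∈ H <;> by_cases h2 : u ∈ G.boundary <;> simp [h1, h2]
  have hdiff : ∀ u v : Fin n, σ 14 u v = 0 ↔
      ∀ w ∈ H, (G.graph.Adj u w ↔ G.graph.Adj v w) := fun u v => by
    rw [f14, Finset.sum_eq_zero_iff]
    refine forall_congr' fun w => ?_
    simp only [Finset.mem_univ, true_imp_iff, hadj, hhub]
    by_cases h1 : w ∈ H <;> by_cases h2 : G.graph.Adj u w <;>
      by_cases h3 : G.graph.Adj v w <;> simp [h1, h2, h3]
  have htwin : ∀ u w : Fin n, σ 13 w w - σ 14 u w = if G.IsTwin H u w then 1 else 0 :=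
    fun u w => by
      have h1 := hdiff u w
      rw [hlow]
      simp only [BoundariedGraph.IsTwin, ← h1]
      by_cases h2 : G.IsLow H w <;> by_cases h3 : σ 14 u w = 0 <;> simp [h2, h3]
      omega
  have hrank : ∀ u : Fin n, σ 15 u u = G.rank H u := fun u => by
    rw [f15, BoundariedGraph.rank, ← sum_ite_eq_ncard]
    refine Finset.sum_congr rfl fun w _ => ?_
    rw [htwin]
    -- The subtracted number `w + 1 - u` is zero exactly when `w < u`.
    by_cases h1 : G.IsTwin H u w <;> by_cases h2 : w < u <;> simp [h1, h2]
    all_goals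
      rw [Fin.lt_def] at h2
      omega
  have hcnt : ∀ u : Fin n, σ 16 u u = {w | G.IsTwin H u w}.ncard := fun u => by
    rw [f16]
    simp only [htwin]
    exact sum_ite_eq_ncard _
  have hheavy : ∀ u v : Fin n, σ 17 u v = if G.IsHeavy H M u then 1 else 0 := fun u v => by
    rw [f17, hlow, hbd, hcnt]
    simp only [BoundariedGraph.IsHeavy]
    by_cases h1 : G.IsLow H u <;>
      by_cases h2 : M < {w | G.IsTwin H u w}.ncard <;> simp only [h1, h2, if_true, if_false,
        true_and, false_and] <;> omega
  have hbad : ∀ u v : Fin n, σ 18 u v = 0 ↔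
      ∀ w, G.graph.Adj u w → w ∈ H ∨ G.IsHeavy H M w := fun u v => by
    rw [f18, Finset.sum_eq_zero_iff]
    refine forall_congr' fun w => ?_
    simp only [Finset.mem_univ, true_imp_iff, hadj, hhub, hheavy]
    by_cases h1 : w ∈ H <;> by_cases h2 : G.graph.Adj u w <;>
      by_cases h3 : G.IsHeavy H M w <;> simp [h1, h2, h3]
  have hkeep : ∀ u v : Fin n, σ 19 u v = if κ u then 1 else 0 := fun u v => by
    have h0 : κ u ↔ G.IsKept H M u := ⟨fun h => h.2, fun h => ⟨u.2, h⟩⟩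
    have h3 := hbad u u
    rw [f19, hlow, hbd, hrank]
    simp only [h0, BoundariedGraph.IsKept, ← h3]
    by_cases h1 : G.IsLow H u <;> by_cases h2 : M < G.rank H u <;>
      by_cases h4 : σ 18 u u = 0 <;> simp only [h1, h2, h4, if_true, if_false,
        true_and, false_and, not_true, not_false_iff, and_self] <;> omega
  have hcount : ∀ m ≤ n, Nat.count κ m =
      ∑ k : Fin n, if κ k ∧ (k : ℕ) < m then 1 else 0 := fun m hm => by
    rw [Nat.count_eq_card_filter_range,
      ← Finset.sum_range fun k => if κ k ∧ k < m then 1 else 0, Finset.sum_boole, Nat.cast_id]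
    congr 1
    ext k
    simp only [Finset.mem_filter, Finset.mem_range]
    constructor
    · exact fun h => ⟨h.1.trans_le hm, h.2, h.1⟩
    · exact fun h => ⟨h.2.2, h.2.1⟩
  have hprefix : ∀ u v : Fin n, σ 20 u v = Nat.count κ (u + 1) := fun u v => by
    rw [f20, hcount _ u.2]
    refine Finset.sum_congr rfl fun k _ => ?_
    rw [hkeep]
    by_cases h1 : κ k <;> by_cases h2 : (k : ℕ) < u + 1 <;> simp [h1, h2] <;> omega
  have hlt : ∀ i < Nat.count κ n, i < n := fun i hi => hi.trans_le (Nat.count_le _)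
  have hpos : ∀ i < Nat.count κ n, ∀ j < n, σ 21 i j = Nat.nth κ i := fun i hi j hj => by
    have hnth := Nat.nth_lt_of_lt_count hi
    rw [f21 ⟨i, hlt i hi⟩ ⟨j, hj⟩, ← Finset.card_range (Nat.nth κ i), Finset.card_eq_sum_ones]
    -- The position of the `i`-th kept vertex, counting from `0`, is the number of `k` whose prefix
    -- count, `k` included, is at most `i`.
    have h1 : ∀ k : Fin n, 1 - (σ 20 k k - i) =
        if (k : ℕ) < Nat.nth κ i then 1 else 0 := fun k => by
      rw [hprefix]
      split_ifs with hk
      · have : Nat.count κ (k + 1) ≤ i := Nat.le_nth_of_count_le hk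
        omega
      · have h2 : Nat.count κ (Nat.nth κ i + 1) ≤ Nat.count κ (k + 1) :=
          Nat.count_monotone κ (Nat.succ_le_succ (not_lt.1 hk))
        rw [Nat.count_nth_succ fun hf => hi.trans_le (Nat.count_le_card hf n)] at h2
        omega
    simp only [h1]
    rw [← Finset.sum_range fun k => if k < Nat.nth κ i then 1 else 0, ← Finset.sum_filter]
    refine Finset.sum_congr ?_ fun _ _ => rfl
    ext k
    simp only [Finset.mem_filter, Finset.mem_range]
    omega
  refine ⟨fun i hi j hj => ?_, fun i hi j hj => ?_, fun i hi j hj => ?_⟩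
  · rw [f22 ⟨i, hi⟩ ⟨j, hj⟩, hcount n le_rfl]
    refine Finset.sum_congr rfl fun k _ => ?_
    rw [hkeep]
    simp
  · rw [f23 ⟨i, hlt i hi⟩ ⟨j, hlt j hj⟩, hpos i hi i (hlt i hi), hpos j hj j (hlt j hj)]
  · rw [f24 ⟨i, hlt i hi⟩ ⟨j, hlt j hj⟩, hpos i hi i (hlt i hi)]

/-- The kernelization program. -/
def kernelProgram (h : ℕ) : Program :=
  .cond (scalar 0)
    (.seq (Fill.run (kernelFills h))
      (.seq (Fill.run [⟨1, .cell 23 .row .col, .const 0⟩, ⟨2, .cell 24 .row .col, .const 0⟩])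
        (.assign 0 (.const 0) (.const 0) (scalar 22))))
    .skip

/-- The position in `G` of each vertex of the kernel. -/
noncomputable def keptEmbedding {t : ℕ} (G : BoundariedGraph t) (h m : ℕ)
    (hm : ∀ i < m, ∀ hf : (Set.ofPred (KeptIndex G h)).Finite, i < hf.toFinset.card) :
    Fin m ↪ Fin G.n where
  toFun i := ⟨Nat.nth (KeptIndex G h) i, (Nat.nth_mem _ (hm i i.2)).1⟩
  inj' i j hij := by
    classical
    have := congrArg (Nat.count (KeptIndex G h)) (congrArg Fin.val hij)
    simp only [Nat.count_nth (hm i i.2), Nat.count_nth (hm j j.2)] at this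
    exact Fin.ext this

/-- The kernel is built in separate arrays and copied back only at the end, since it is read off
from the input arrays. The vertex count is overwritten last because it bounds every loop. Fifteen
instructions and two copies give the factor `17`. -/
theorem runs_kernelProgram {t : ℕ} {G : BoundariedGraph t} {h : ℕ} {σ : Memory}
    (hσ : Stores σ G) (hpos : 0 < G.n) :
    Runs (kernelProgram h) σ (17 * Fill.time G.n + 4) fun σ' => σ' 3 = σ 3 ∧
      ∃ (m : ℕ) (f : Fin m ↪ Fin G.n),
        (∀ z, z ∈ Set.range f ↔ G.IsKept (G.hubs h) (h * G.boundary.card) z) ∧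
        Stores σ' (G.pullback f) := by
  classical
  obtain ⟨h0, h1, h2⟩ := hσ
  set m := Nat.count (KeptIndex G h) G.n with hm
  have hmn : m ≤ G.n := Nat.count_le _
  have hrun := (Fill.runs_run (ordered_kernelFills h) h0).seq
    (C := 2 * Fill.time G.n + 1 + 1)
    (q := .seq (Fill.run [⟨1, .cell 23 .row .col, .const 0⟩, ⟨2, .cell 24 .row .col, .const 0⟩])
        (.assign 0 (.const 0) (.const 0) (scalar 22)))
    (Q := fun σ' => σ' 3 = σ 3 ∧ σ' 0 0 0 = m ∧
      (∀ i < m, ∀ j < m,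
        σ' 1 i j = σ 1 (Nat.nth (KeptIndex G h) i) (Nat.nth (KeptIndex G h) j)) ∧
      ∀ i < m, σ' 2 i 0 = σ 2 (Nat.nth (KeptIndex G h) i) 0) ?_
  · obtain ⟨T, σ', hE, hT, h3, hm', hA, hL⟩ := hrun
    set f := keptEmbedding G h m fun i hi hf => hi.trans_le (Nat.count_le_card hf _)
    refine ⟨1 + T, σ', .cond_true (by simp only [Expr.val]; omega) hE, ?_, h3, m, f, ?_, hm',
      ?_, ?_⟩
    · have : (kernelFills h).length = 15 := rfl
      rw [this] at hT
      omega
    · intro z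
      constructor
      · rintro ⟨i, rfl⟩
        exact (Nat.nth_mem (p := KeptIndex G h) i
          fun hf => i.2.trans_le (Nat.count_le_card hf _)).2
      · intro hz
        have hz' : KeptIndex G h z := ⟨z.2, hz⟩
        exact ⟨⟨Nat.count (KeptIndex G h) z, Nat.count_strict_mono hz' z.2⟩,
          Fin.ext (Nat.nth_count hz')⟩
    · intro (u : Fin m) (v : Fin m)
      rw [hA u u.2 v v.2]
      exact h1 (f u) (f v)
    · intro (v : Fin m)
      rw [hL v v.2]
      exact h2 (f v)
  · rintro τ ⟨hb, hfill⟩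
    have hb' : ∀ b < 10, τ b = σ b := fun b hlt => hb b (by omega) fun I hI => by
      have : ∀ I ∈ kernelFills h, 10 ≤ I.target := by simp [kernelFills]
      have := this I hI
      omega
    obtain ⟨s22, s23, s24⟩ := kernelFills_spec (G := G) (σ := τ) (h := h)
      (fun u v => by
        rw [hb' 1 (by omega)]
        split_ifs with huv
        exacts [(h1 u v).1 huv, (h1 u v).2 huv])
      (fun v => by
        rw [hb' 2 (by omega), h2]
        cases hl : G.label v with
        | none =>
          rw [if_neg (BoundariedGraph.label_eq_none_iff.1 hl)]
          rfl
        | some i =>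
          rw [if_pos (BoundariedGraph.mem_boundary.2 ⟨i, hl⟩)]
          simp)
      hfill
    refine (Fill.runs_run (n := G.n) ?_ (by rw [hb' 0 (by omega), h0])).seq fun ρ hρ => .assign ?_
    · simp [Fill.Ordered, Fill.wellFormed_iff, Term.Reads]
    · obtain ⟨hρ, hv⟩ := hρ
      have hρ' : ∀ b < 100, b ≠ 1 → b ≠ 2 → ρ b = τ b := fun b hlt hb1 hb2 =>
        hρ b hlt (by simp [hb1, hb2])
      simp only [List.forall_mem_cons, Fill.value, Term.val, Finset.sum_const_zero,
        add_zero] at hv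
      obtain ⟨v1, v2, -⟩ := hv
      refine ⟨?_, ?_, fun i hi j hj => ?_, fun i hi => ?_⟩
      · rw [Memory.write_array_ne (by omega), hρ' 3 (by omega) (by omega) (by omega),
          hb' 3 (by omega)]
      · rw [Expr.val, Memory.write_same]
        simp only [Expr.val]
        rw [hρ' 22 (by omega) (by omega) (by omega), s22 0 hpos 0 hpos]
      · rw [Memory.write_array_ne (by omega), v1 i (by omega) j (by omega),
          hρ' 23 (by omega) (by omega) (by omega), s23 i hi j hj, hb' 1 (by omega)]
      · rw [Memory.write_array_ne (by omega), v2 i (by omega) 0 hpos,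
          hρ' 24 (by omega) (by omega) (by omega), s24 i hi 0 (by omega), hb' 2 (by omega)]

theorem stores_input {t : ℕ} (G : BoundariedGraph t) : Stores (input G) G := by
  refine ⟨by simp [input], fun u v => ⟨fun h => ?_, fun h => ?_⟩, fun v => ?_⟩
  · have : ∃ u' v' : Fin G.n, (u' : ℕ) = u ∧ (v' : ℕ) = v ∧ G.graph.Adj u' v' :=
      ⟨u, v, rfl, rfl, h⟩
    simp only [input]
    rw [if_neg (by simp), if_pos trivial, if_pos this]
  · have : ¬ ∃ u' v' : Fin G.n, (u' : ℕ) = u ∧ (v' : ℕ) = v ∧ G.graph.Adj u' v' := by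
      rintro ⟨u', v', hu, hv, h'⟩
      rw [Fin.ext hu, Fin.ext hv] at h'
      exact h h'
    simp only [input]
    rw [if_neg (by simp), if_pos trivial, if_neg this]
  · simp [input]

theorem outputInt_eq_zero {t : ℕ} {G : BoundariedGraph t} {σ : Memory}
    (h : σ 3 = input G 3) : outputInt σ = 0 := by
  simp [outputInt, h, input]

end RAM

/-! ### Assembling the result -/

theorem mainTheorem8 (h' : ℕ) :
    ∃ (δ : ℕ) (prog : RAM.Program) (time : Polynomial ℕ),
      ∀ (t : ℕ) (G : BoundariedGraph t),
        IsDominatingSet G.graph G.boundary →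
        {v | h' ≤ (G.graph.neighborSet v).ncard}.ncard ≤ h' →
        ∃ (T : ℕ) (σ : RAM.Memory) (G' : BoundariedGraph t) (c : ℤ),
          RAM.Exec prog (RAM.input G) T σ ∧
          T ≤ time.eval G.n ∧
          RAM.Stores σ G' ∧
          RAM.outputInt σ = c ∧
          G.SameBoundary G' ∧
          BoundariedGraph.Equivalent DS G' G ∧
          G'.n ≤ δ * G.boundary.card ∧
          BoundariedGraph.IsTranspositionConstant DS G G' c := by
  refine ⟨h' + 1 + 2 ^ h' * (h' + 1) + (1 + 2 ^ h' * (h' + 1)) * h', RAM.kernelProgram h',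
    17 * (Polynomial.X * (Polynomial.X * (Polynomial.X * 3 + 6) + 4) + 2) + 4, ?_⟩
  intro t G hG hhubs
  have htime : (17 * (Polynomial.X * (Polynomial.X * (Polynomial.X * 3 + 6) + 4) + 2) + 4 :
      Polynomial ℕ).eval G.n = 17 * RAM.Fill.time G.n + 4 := by
    simp [RAM.Fill.time]
  rw [htime]
  rcases Nat.eq_zero_or_pos G.n with h0 | hpos
  · have hc : BoundariedGraph.IsTranspositionConstant DS G G 0 := fun F k => by rw [add_zero]
    -- The empty graph is returned unchanged: the linear bound on kept vertices needs a nonempty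
    -- boundary, and no cell of array `22` would be filled.
    refine ⟨1 + 1, RAM.input G, G, 0, .cond_false ?_ (.skip _), by omega, RAM.stores_input G,
      RAM.outputInt_eq_zero rfl, fun _ => Iff.rfl, ⟨0, hc⟩, by omega, hc⟩
    simp [RAM.Expr.val, RAM.input, h0]
  · obtain ⟨T, σ, hE, hT, h3, m, f, hf, hσ⟩ :=
      RAM.runs_kernelProgram (h := h') (RAM.stores_input G) hpos
    have hc := BoundariedGraph.isTranspositionConstant_pullback_isKept hG f hf
    refine ⟨T, σ, G.pullback f, 0, hE, hT, hσ, RAM.outputInt_eq_zero h3, fun i => ⟨?_, ?_⟩,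
      ⟨0, hc.symm_zero⟩, ?_, hc⟩
    · rintro ⟨v, hv⟩
      -- Boundary vertices are not low, so they are never deleted.
      obtain ⟨u, rfl⟩ := (hf v).2 fun hk => hk.1.2 (BoundariedGraph.mem_boundary.2 ⟨i, hv⟩)
      exact ⟨u, hv⟩
    · rintro ⟨u, hu⟩
      exact ⟨f u, hu⟩
    · have hS : 0 < G.boundary.card := by
        rw [Finset.card_pos]
        rcases hG ⟨0, hpos⟩ with h | ⟨u, hu, -⟩
        exacts [⟨_, h⟩, ⟨u, hu⟩]
      refine le_of_eq_of_le ?_ (BoundariedGraph.ncard_isKept_hubs_le hS hhubs)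
      have : {z | G.IsKept (G.hubs h') (h' * G.boundary.card) z} = Set.range f :=
        Set.ext fun z => (hf z).symm
      rw [this, ← Set.image_univ, Set.ncard_image_of_injective _ f.injective, Set.ncard_univ,
        Nat.card_fin]
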